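/- Let $Q$ be a probability measure on $\mathbb{R}$ that has a density $q\ge 0$ with respect to Lebesgue measure on $\mathbb{R}$ or with respect to the counting measure on the integers. Let $Z(\beta)=\int e^{\beta x}\,dQ(x)$, $\Gamma^{\mathrm{can}}=\{\beta : Z(\beta)<\infty\}$, and $\frac{dP_\beta}{dQ}(x)=e^{\beta x}/Z(\beta)$ for $\beta\in\Gamma^{\mathrm{can}}$. Assume that $\beta_{\sup}=\sup\Gamma^{\mathrm{can}}=0$. Let $\beta_0$ be an interior point of $\Gamma^{\mathrm{can}}$ and consider the left-truncated exponential family $(P_\beta)_{\beta\in\Gamma_0^{\mathrm{can}}}$, where $\Gamma_0^{\mathrm{can}}=\Gamma^{\mathrm{can}}\cap[\beta_0,\infty)$. Let $M$ be the set of its finite mean values. For $x$ in the convex core $cc(Q)$ (the intersection of all convex measurable sets of $Q$-probability $1$), let $P^x$ be the element with mean $x$ of the full family $(P_\beta)_{\beta\in\Gamma^{\mathrm{can}}}$ if there is one, and otherwise the maximum likelihood distribution at $x$: the element $P_\beta$ for which $\beta x-\ln Z(\beta)$ is maximal, or $\delta_x$ if no maximum is attained (which happens exactly when $x$ is an extreme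 point of $cc(Q)$). Let $V(x)$ be the variance of $P^x$ for $x\in M$. The Jeffreys integral is $$J=\int_M V(x)^{-1/2}\,dx,$$ and for $m\ge 1$ and a sample $x^m=(x_1,\dots,x_m)$ of points of $cc(Q)$ with average $\bar x$ the conditional Jeffreys integral is $$J\mid x^m=\int_M \exp\bigl(-m\,D(P^{\bar x}\,\|\,P^{x})\bigr)\,V(x)^{-1/2}\,dx ,$$ where $D$ is the Kullback--Leibler divergence. 1. If $q$ is heavy tailed, i.e. $\int e^{tx}\,dQ(x)=\infty$ for all $t>0$, then $J<\infty$ if and only if $J\mid x^m<\infty$ for all $m\ge1$ and all samples $x^m$ of points of $cc(Q)$. 2. If $q(x)=O(x^{-1-\alpha})$ as $x\to\infty$ for some $\alpha>0$, then $J<\infty$. -/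

import Mathlib

open MeasureTheory ProbabilityTheory Filter
open scoped ENNReal Asymptotics

noncomputable section

namespace ExpFamily

/-- The canonical parameter space: all `β` with `Z(β) = ∫ exp(β x) dQ(x) < ∞`. -/
def canonicalSpace (Q : Measure ℝ) : Set ℝ :=
  {β | Integrable (fun x : ℝ => Real.exp (β * x)) Q}

/-- The element `P_β` of the exponential family based on `Q`, with `dP_β/dQ = exp(β x) / Z(β)`. -/
def element (Q : Measure ℝ) (β : ℝ) : Measure ℝ :=
  Q.tilted (fun x => β * x)

/-- The mean value `μ_β` of `P_β`. -/
def mean (Q : Measure ℝ) (β : ℝ) : ℝ := ∫ x, x ∂(element Q β)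

/-- The parameters of a set `Γ` at which `P_β` has a finite mean. -/
def finiteMean (Q : Measure ℝ) (Γ : Set ℝ) : Set ℝ :=
  {β ∈ Γ | Integrable (fun x : ℝ => x) (element Q β)}

/-- The (finite part of the) mean value range of the family `(P_β)`, `β ∈ Γ`. -/
def meanRange (Q : Measure ℝ) (Γ : Set ℝ) : Set ℝ := mean Q '' finiteMean Q Γ

/-- The canonical parameter space `Γ₀` of the family truncated to the left at `β₀`. -/
def leftTruncated (Q : Measure ℝ) (β₀ : ℝ) : Set ℝ := canonicalSpace Q ∩ Set.Ici β₀

/-- The convex core: the intersection of all convex measurable sets of `Q`-probability 1. -/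
def convexCore (Q : Measure ℝ) : Set ℝ :=
  ⋂₀ {s | Convex ℝ s ∧ MeasurableSet s ∧ Q s = 1}

/-- The logarithm `β x - ln Z(β)` of the density of `P_β` with respect to `Q`. -/
def logLik (Q : Measure ℝ) (x β : ℝ) : ℝ :=
  β * x - Real.log (∫ y, Real.exp (β * y) ∂Q)

open Classical in
/-- The distribution `P^x`, for `x` in the convex core.
If `x` belongs to the mean value range of the full family, it is the element of mean `x`.
Otherwise it is the maximum likelihood distribution at `x`. That is an element of the family,
except when `x` is an extreme point of the convex core, where it is the element `δ_x` of the
extended family. -/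
def atMean (Q : Measure ℝ) (x : ℝ) : Measure ℝ :=
  if x ∈ meanRange Q (canonicalSpace Q) then
    element Q (Function.invFunOn (mean Q) (finiteMean Q (canonicalSpace Q)) x)
  else if h : ∃ β ∈ canonicalSpace Q, IsMaxOn (logLik Q x) (canonicalSpace Q) β then
    element Q h.choose
  else Measure.dirac x

/-- The variance function `V`. -/
def varFun (Q : Measure ℝ) (x : ℝ) : ℝ≥0∞ := evariance (fun y : ℝ => y) (atMean Q x)

/-- The Jeffreys integral `∫_M V(x)^{-1/2} dx` of the family `(P_β)`, `β ∈ Γ`. -/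
def jeffreys (Q : Measure ℝ) (Γ : Set ℝ) : ℝ≥0∞ :=
  ∫⁻ x in meanRange Q Γ, varFun Q x ^ (-(1 / 2) : ℝ)

/-- The average of a sample. -/
def sampleMean {m : ℕ} (s : Fin m → ℝ) : ℝ := (∑ i, s i) / m

/-- The conditional Jeffreys integral `∫_M exp(-m D(P^{x̄} ‖ P^x)) V(x)^{-1/2} dx` of the family
`(P_β)`, `β ∈ Γ`, given a sample of size `m` with average `x̄`. -/
def condJeffreys (Q : Measure ℝ) (Γ : Set ℝ) {m : ℕ} (s : Fin m → ℝ) : ℝ≥0∞ :=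
  ∫⁻ x in meanRange Q Γ,
    EReal.exp (-((m * InformationTheory.klDiv (atMean Q (sampleMean s)) (atMean Q x) : ℝ≥0∞) :
      EReal)) * varFun Q x ^ (-(1 / 2) : ℝ)

/-- A distribution is heavy tailed (to the right) if it has no positive exponential moment. -/
def IsHeavyTailed (Q : Measure ℝ) : Prop :=
  ∀ t : ℝ, 0 < t → ∫⁻ x, ENNReal.ofReal (Real.exp (t * x)) ∂Q = ∞

/-- The counting measure of the integers, as a measure on the real line. -/
def countingMeasure : Measure ℝ := Measure.map (fun k : ℤ => (k : ℝ)) Measure.count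

end ExpFamily

end

namespace ExpFamily

variable {Q : Measure ℝ}

/-! Since `dμ_β/dβ = Var P_β`, substituting `x = μ_β` turns `J` into the integral of `√(Var P_β)`
over `(β₀, 0)`; the bound `≤` (`jeffreys_le_lintegral_variance`) suffices.

For 1, nonnegativity of the divergence gives one direction. Conversely, condition on the mean of one
`P_β₁` with `β₁ ∈ (β₀, 0)`. As `Z` is finite at both `β₀` and `0`, `D(P_β₁ ‖ P_β)` is bounded over
`β ∈ (β₀, 0)` (`exists_klDiv_element_le`), so the weight `exp(-D)` is bounded away from `0`.

For 2, the tail bound gives a right moment of some order `ε > 0`, hence `Var P_β = O(|β|^(ε-2))`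
(`exists_variance_element_le`). The square root `|β|^(ε/2-1)` is integrable at `0`. -/

lemma zero_mem_canonicalSpace [IsFiniteMeasure Q] : (0 : ℝ) ∈ canonicalSpace Q := by
  simp [canonicalSpace]

lemma Ioo_subset_interior_canonicalSpace [IsFiniteMeasure Q] {β₀ : ℝ} (h : β₀ < 0)
    (hβ₀ : β₀ ∈ interior (canonicalSpace Q)) :
    Set.Ioo β₀ 0 ⊆ interior (canonicalSpace Q) := by
  rw [← openSegment_eq_Ioo h]
  exact (convex_integrableExpSet (X := id) (μ := Q)).openSegment_interior_self_subset_interior hβ₀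
    zero_mem_canonicalSpace

lemma neg_of_mem_interior_canonicalSpace {β₀ : ℝ} (hsup : IsLUB (canonicalSpace Q) 0)
    (hβ₀ : β₀ ∈ interior (canonicalSpace Q)) : β₀ < 0 := by
  have h : canonicalSpace Q ⊆ Set.Iic 0 := fun β hβ => hsup.1 hβ
  simpa using interior_mono h hβ₀

/-- A measure with bounded above canonical parameter space is not a point mass. -/
lemma not_ae_eq_const [IsFiniteMeasure Q] (hsup : IsLUB (canonicalSpace Q) 0) (c : ℝ) :
    ¬ ∀ᵐ x ∂Q, x = c := by
  intro h
  have h1 : (1 : ℝ) ∈ canonicalSpace Q := by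
    refine (integrable_const (Real.exp (1 * c))).congr ?_
    filter_upwards [h] with x hx
    rw [hx]
  linarith [hsup.1 h1]

/-! ### Tilting and moments of the elements -/

lemma isProbabilityMeasure_element [NeZero Q] {β : ℝ} (hβ : β ∈ canonicalSpace Q) :
    IsProbabilityMeasure (element Q β) :=
  isProbabilityMeasure_tilted hβ

/-- Tilts compose, so any element can replace `Q` as base measure. -/
lemma element_tilted {β : ℝ} (hβ : β ∈ canonicalSpace Q) (β' : ℝ) :
    (element Q β).tilted (fun x => (β' - β) * x) = element Q β' := by
  rw [element, tilted_tilted hβ, element]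
  congr 1
  ext x
  simp only [Pi.add_apply]
  ring

lemma integrable_exp_element {β β' : ℝ} (hβ : β ∈ canonicalSpace Q)
    (hβ' : β' ∈ canonicalSpace Q) :
    Integrable (fun x => Real.exp ((β' - β) * x)) (element Q β) := by
  rw [element, integrable_tilted_iff hβ]
  refine Integrable.congr hβ' (ae_of_all _ fun x => ?_)
  simp only [smul_eq_mul]
  rw [← Real.exp_add]
  congr 1
  ring

lemma memLp_element {β : ℝ} (hβ : β ∈ interior (canonicalSpace Q)) :
    MemLp (fun x : ℝ => x) 2 (element Q β) := by
  have := memLp_tilted_mul (X := id) (μ := Q) hβ 2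
  exact_mod_cast this

lemma integrable_element [NeZero Q] {β : ℝ} (hβ : β ∈ interior (canonicalSpace Q)) :
    Integrable (fun x : ℝ => x) (element Q β) := by
  have := isProbabilityMeasure_element (interior_subset hβ)
  exact (memLp_element hβ).integrable one_le_two

lemma mem_finiteMean [NeZero Q] {β : ℝ} (hβ : β ∈ interior (canonicalSpace Q)) :
    β ∈ finiteMean Q (canonicalSpace Q) :=
  ⟨interior_subset hβ, integrable_element hβ⟩

/-! ### The mean value map and its range -/

/-- The mean value is strictly increasing in the canonical parameter. -/
lemma mean_strictMonoOn [NeZero Q] (hQ : ∀ c, ¬ ∀ᵐ x ∂Q, x = c) :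
    StrictMonoOn (mean Q) (finiteMean Q (canonicalSpace Q)) := by
  intro β hβ β' hβ' hlt
  have hP := isProbabilityMeasure_element hβ.1
  have hP' := isProbabilityMeasure_element hβ'.1
  have hexp := integrable_exp_element hβ.1 hβ'.1
  set P := element Q β
  set c := mean Q β with hc
  -- Chebyshev's argument: both factors change sign at `c`, and the integral of `f` is a positive
  -- multiple of `mean Q β' - c`.
  set f : ℝ → ℝ := fun x => (Real.exp ((β' - β) * x) - Real.exp ((β' - β) * c)) * (x - c) with hf
  have hγ : 0 < β' - β := sub_pos.2 hlt
  have hf0 : 0 ≤ f := by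
    intro x
    rcases le_total x c with h | h
    · exact mul_nonneg_of_nonpos_of_nonpos
        (sub_nonpos.2 (Real.exp_le_exp.2 (mul_le_mul_of_nonneg_left h hγ.le))) (sub_nonpos.2 h)
    · exact mul_nonneg
        (sub_nonneg.2 (Real.exp_le_exp.2 (mul_le_mul_of_nonneg_left h hγ.le))) (sub_nonneg.2 h)
  have hxP : Integrable (fun x : ℝ => x - c) P := hβ.2.sub (integrable_const c)
  have hxP' : Integrable (fun x : ℝ => x - c) (element Q β') := hβ'.2.sub (integrable_const c)
  have hI : Integrable (fun x => Real.exp ((β' - β) * x) * (x - c)) P := by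
    rw [← element_tilted hβ.1 β', integrable_tilted_iff hexp] at hxP'
    exact hxP'
  have hfeq : f = fun x => Real.exp ((β' - β) * x) * (x - c)
      - Real.exp ((β' - β) * c) * (x - c) := by
    ext x; simp only [hf]; ring
  have hfi : Integrable f P := by
    rw [hfeq]; exact hI.sub (hxP.const_mul _)
  have h0 : ∫ x, (x - c) ∂P = 0 := by
    rw [integral_sub hβ.2 (integrable_const c)]
    simp [hc, mean]
  have hfint : ∫ x, f x ∂P = ∫ x, Real.exp ((β' - β) * x) * (x - c) ∂P := by
    rw [hfeq, integral_sub hI (hxP.const_mul _), integral_const_mul, h0]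
    simp
  have hpos : 0 < ∫ x, f x ∂P := by
    refine lt_of_le_of_ne (integral_nonneg hf0) fun h => ?_
    have h2 := (integral_eq_zero_iff_of_nonneg hf0 hfi).1 h.symm
    refine hQ c ((absolutelyContinuous_tilted hβ.1).ae_le ?_)
    change ∀ᵐ x ∂P, x = c
    filter_upwards [h2] with x hx
    rcases mul_eq_zero.1 hx with h3 | h3
    · have := Real.exp_injective (sub_eq_zero.1 h3)
      exact mul_left_cancel₀ hγ.ne' this
    · exact sub_eq_zero.1 h3
  have hfin : mean Q β' - c = (∫ x, f x ∂P) / ∫ x, Real.exp ((β' - β) * x) ∂P := by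
    have : mean Q β' - c = ∫ x, (x - c) ∂(element Q β') := by
      rw [integral_sub hβ'.2 (integrable_const c)]
      simp [mean]
    rw [this, ← element_tilted hβ.1 β', integral_tilted, hfint, ← integral_div]
    refine integral_congr_ae (ae_of_all _ fun x => ?_)
    simp only [smul_eq_mul]
    ring
  have := div_pos hpos (integral_exp_pos hexp)
  linarith

lemma atMean_mean [NeZero Q] (hQ : ∀ c, ¬ ∀ᵐ x ∂Q, x = c) {β : ℝ}
    (hβ : β ∈ finiteMean Q (canonicalSpace Q)) : atMean Q (mean Q β) = element Q β := by
  have hmem : mean Q β ∈ meanRange Q (canonicalSpace Q) := ⟨β, hβ, rfl⟩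
  rw [atMean, if_pos hmem, (mean_strictMonoOn hQ).injOn.leftInvOn_invFunOn hβ]

/-- Near an interior point the mean is the first derivative of the analytic function `cgf id Q`, and
the variance is its second. -/
lemma hasDerivAt_mean [NeZero Q] {β : ℝ} (hβ : β ∈ interior (canonicalSpace Q)) :
    HasDerivAt (mean Q) (variance (fun x : ℝ => x) (element Q β)) β := by
  have hv : variance (fun x : ℝ => x) (element Q β) = deriv (deriv (cgf id Q)) β := by
    have := variance_tilted_mul (X := id) (μ := Q) hβ
    rw [iteratedDeriv_succ, iteratedDeriv_one] at this
    exact this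
  rw [hv]
  have hd : DifferentiableAt ℝ (deriv (cgf id Q)) β :=
    (analyticAt_cgf (X := id) (μ := Q) hβ).deriv.differentiableAt
  refine hd.hasDerivAt.congr_of_eventuallyEq ?_
  filter_upwards [isOpen_interior.mem_nhds hβ] with t ht
  exact integral_tilted_mul_self (X := id) (μ := Q) ht

/-- The finite mean values belong to the convex core. -/
lemma mean_mem_convexCore [IsProbabilityMeasure Q] {β : ℝ}
    (hβ : β ∈ finiteMean Q (canonicalSpace Q)) :
    mean Q β ∈ convexCore Q := by
  rintro s ⟨hs, hsm, hs1⟩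
  have hP := isProbabilityMeasure_element hβ.1
  have hae : ∀ᵐ x ∂Q, x ∈ s := by
    rw [ae_iff]
    change Q sᶜ = 0
    rw [measure_compl hsm (measure_ne_top _ _), hs1, measure_univ, tsub_self]
  -- The deviation from the mean integrates to zero, so it cannot have a strict sign almost
  -- everywhere; a convex set missing the mean lies on one side of it.
  have hne : ∀ g : ℝ → ℝ, (g = fun x => x - mean Q β) ∨ (g = fun x => -(x - mean Q β)) →
      ¬ ∀ᵐ x ∂Q, 0 < g x := by
    intro g hg h
    have hi : Integrable (fun x : ℝ => x - mean Q β) (element Q β) :=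
      hβ.2.sub (integrable_const _)
    have h0 : ∫ x, (x - mean Q β) ∂(element Q β) = 0 := by
      rw [integral_sub hβ.2 (integrable_const _)]
      simp [mean]
    have hgi : Integrable g (element Q β) := by
      rcases hg with rfl | rfl
      exacts [hi, hi.neg]
    have hg0 : ∫ x, g x ∂(element Q β) = 0 := by
      rcases hg with rfl | rfl
      · exact h0
      · rw [integral_neg, h0, neg_zero]
    have h' : ∀ᵐ x ∂(element Q β), 0 < g x := (tilted_absolutelyContinuous _ _).ae_le h
    have h2 := (integral_eq_zero_iff_of_nonneg_ae (h'.mono fun x hx => hx.le) hgi).1 hg0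
    obtain ⟨x, hx, hx'⟩ := (h'.and h2).exists
    exact hx.ne' hx'
  by_contra hns
  have hoc := hs.ordConnected
  by_cases hlt : ∃ y ∈ s, y < mean Q β
  · obtain ⟨y, hy, hyl⟩ := hlt
    refine hne _ (Or.inr rfl) ?_
    filter_upwards [hae] with x hx
    by_contra h
    exact hns (hoc.out hy hx ⟨hyl.le, by linarith⟩)
  · push Not at hlt
    refine hne _ (Or.inl rfl) ?_
    filter_upwards [hae] with x hx
    exact sub_pos.2 (lt_of_le_of_ne (hlt x hx) fun h => hns (h ▸ hx))

/-- Up to its end points, the mean value range of the left truncated family is the image of an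
open interval. -/
lemma meanRange_leftTruncated_ae_eq [IsProbabilityMeasure Q] {β₀ : ℝ}
    (hsup : IsLUB (canonicalSpace Q) 0) (hβ₀ : β₀ ∈ interior (canonicalSpace Q)) :
    meanRange Q (leftTruncated Q β₀) =ᵐ[volume] mean Q '' Set.Ioo β₀ 0 := by
  have hsub := Ioo_subset_interior_canonicalSpace (neg_of_mem_interior_canonicalSpace hsup hβ₀) hβ₀
  have h1 : mean Q '' Set.Ioo β₀ 0 ⊆ meanRange Q (leftTruncated Q β₀) := by
    rintro _ ⟨β, hβ, rfl⟩
    have := mem_finiteMean (hsub hβ)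
    exact ⟨β, ⟨⟨this.1, hβ.1.le⟩, this.2⟩, rfl⟩
  -- If `P_0` has no finite mean, `mean Q 0` is the default `0`, merely a superfluous null point.
  have h2 : meanRange Q (leftTruncated Q β₀) \ mean Q '' Set.Ioo β₀ 0
      ⊆ {mean Q β₀, mean Q 0} := by
    rintro _ ⟨⟨β, ⟨⟨hβ, hβ1⟩, -⟩, rfl⟩, hn⟩
    rcases eq_or_lt_of_le (show β₀ ≤ β from hβ1) with rfl | h
    · simp
    rcases eq_or_lt_of_le (hsup.1 hβ) with rfl | h'
    · simp
    exact absurd ⟨β, ⟨h, h'⟩, rfl⟩ hn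
  refine Filter.EventuallyLE.antisymm ?_ (ae_of_all _ h1)
  exact ae_le_set.2 (measure_mono_null h2 ((Set.toFinite _).measure_zero _))

lemma measurableSet_image_mean [IsProbabilityMeasure Q] {β₀ : ℝ}
    (hsup : IsLUB (canonicalSpace Q) 0) (hβ₀ : β₀ ∈ interior (canonicalSpace Q)) :
    MeasurableSet (mean Q '' Set.Ioo β₀ 0) := by
  have hsub := Ioo_subset_interior_canonicalSpace (neg_of_mem_interior_canonicalSpace hsup hβ₀) hβ₀
  refine measurableSet_Ioo.image_of_continuousOn_injOn
    (fun β hβ => (hasDerivAt_mean (hsub hβ)).continuousAt.continuousWithinAt) ?_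
  exact (mean_strictMonoOn (not_ae_eq_const hsup)).injOn.mono fun β hβ => mem_finiteMean (hsub hβ)

/-! ### Bounded divergence and the conditional integral -/

/-- The divergences from a fixed interior element to the elements of the left truncated family are
bounded. -/
lemma exists_klDiv_element_le [IsProbabilityMeasure Q] {β₀ β₁ : ℝ}
    (hβ₀ : β₀ ∈ canonicalSpace Q) (hβ₁ : β₁ ∈ finiteMean Q (canonicalSpace Q))
    (hβ₁0 : β₁ ∈ Set.Ioo β₀ 0) :
    ∃ C : ℝ, ∀ β ∈ canonicalSpace Q, β ∈ Set.Ioo β₀ 0 →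
      InformationTheory.klDiv (element Q β₁) (element Q β) ≤ ENNReal.ofReal C := by
  have hP := isProbabilityMeasure_element hβ₁.1
  have h0 := integrable_exp_element hβ₁.1 hβ₀
  have h00 := integrable_exp_element hβ₁.1 (zero_mem_canonicalSpace (Q := Q))
  -- The terms bound `(β₁ - β) μ_β₁` and the log-normalizer, the latter by `log y ≤ y - 1` and
  -- domination of `exp((β - β₁) x)` by the sum of its values at `β = β₀` and `β = 0`.
  refine ⟨-β₀ * |mean Q β₁| + ∫ x, (Real.exp ((β₀ - β₁) * x) + Real.exp ((0 - β₁) * x))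
    ∂(element Q β₁), fun β hβ hβ0 => ?_⟩
  have hexp := integrable_exp_element hβ₁.1 hβ
  have hPβ := isProbabilityMeasure_element hβ
  have hlin : Integrable (fun x => (β - β₁) * x) (element Q β₁) := hβ₁.2.const_mul _
  have hllr : llr (element Q β₁) (element Q β₁) =ᵐ[element Q β₁] 0 := llr_self _
  have hint : Integrable (llr (element Q β₁) (element Q β₁)) (element Q β₁) :=
    (integrable_zero _ _ _).congr hllr.symm
  have hac : element Q β₁ ≪ element Q β := by
    rw [← element_tilted hβ₁.1 β]; exact absolutelyContinuous_tilted hexp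
  have hint2 : Integrable (llr (element Q β₁) (element Q β)) (element Q β₁) := by
    rw [← element_tilted hβ₁.1 β]
    exact integrable_llr_tilted_right Measure.AbsolutelyContinuous.rfl hlin hint hexp
  rw [InformationTheory.klDiv_of_ac_of_integrable hac hint2]
  refine ENNReal.ofReal_le_ofReal ?_
  have key : ∫ x, llr (element Q β₁) (element Q β) x ∂(element Q β₁)
      = - ((β - β₁) * mean Q β₁)
        + Real.log (∫ x, Real.exp ((β - β₁) * x) ∂(element Q β₁)) := by
    have := integral_llr_tilted_right Measure.AbsolutelyContinuous.rfl hlin hexp hint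
    rw [element_tilted hβ₁.1 β, integral_congr_ae hllr, integral_const_mul] at this
    rw [this]
    simp [mean]
  rw [key]
  simp only [probReal_univ, add_sub_cancel_right]
  refine add_le_add ?_ ?_
  · have h1 : |β - β₁| ≤ -β₀ := abs_le.2 ⟨by linarith [hβ0.1, hβ₁0.2], by linarith [hβ0.2, hβ₁0.1]⟩
    calc -((β - β₁) * mean Q β₁) ≤ |(β - β₁) * mean Q β₁| := neg_le_abs _
      _ = |β - β₁| * |mean Q β₁| := abs_mul _ _
      _ ≤ _ := by gcongr
  · refine (Real.log_le_sub_one_of_pos (integral_exp_pos hexp)).trans ?_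
    refine (sub_le_self _ zero_le_one).trans (integral_mono hexp (h0.add h00) fun x => ?_)
    rcases le_total 0 x with h | h
    · have : Real.exp ((β - β₁) * x) ≤ Real.exp ((0 - β₁) * x) :=
        Real.exp_le_exp.2 (mul_le_mul_of_nonneg_right (by linarith [hβ0.2]) h)
      dsimp only
      linarith [Real.exp_pos ((β₀ - β₁) * x)]
    · have : Real.exp ((β - β₁) * x) ≤ Real.exp ((β₀ - β₁) * x) :=
        Real.exp_le_exp.2 (mul_le_mul_of_nonpos_right (by linarith [hβ0.1]) h)
      dsimp only
      linarith [Real.exp_pos ((0 - β₁) * x)]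

lemma condJeffreys_le_jeffreys (Γ : Set ℝ) {m : ℕ} (s : Fin m → ℝ) :
    condJeffreys Q Γ s ≤ jeffreys Q Γ := by
  refine lintegral_mono fun x => ?_
  refine mul_le_of_le_one_left' ?_
  rw [EReal.exp_le_one_iff, EReal.neg_le_zero]
  exact EReal.coe_ennreal_nonneg _

lemma jeffreys_lt_top_iff_condJeffreys_lt_top [IsProbabilityMeasure Q] {β₀ : ℝ}
    (hsup : IsLUB (canonicalSpace Q) 0) (hβ₀ : β₀ ∈ interior (canonicalSpace Q)) :
    jeffreys Q (leftTruncated Q β₀) < ∞ ↔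
      ∀ m : ℕ, 1 ≤ m → ∀ s : Fin m → ℝ, (∀ i, s i ∈ convexCore Q) →
        condJeffreys Q (leftTruncated Q β₀) s < ∞ := by
  refine ⟨fun h m _ s _ => (condJeffreys_le_jeffreys _ s).trans_lt h, fun h => ?_⟩
  have hneg := neg_of_mem_interior_canonicalSpace hsup hβ₀
  have hsub := Ioo_subset_interior_canonicalSpace hneg hβ₀
  have hQ := not_ae_eq_const hsup
  -- Any point of `(β₀, 0)` would do.
  have hβ₁ : β₀ / 2 ∈ Set.Ioo β₀ 0 := ⟨by linarith, by linarith⟩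
  have hfin := mem_finiteMean (hsub hβ₁)
  obtain ⟨C, hC⟩ := exists_klDiv_element_le (interior_subset hβ₀) hfin hβ₁
  have hlt := h 1 le_rfl (fun _ => mean Q (β₀ / 2))
    fun _ => mean_mem_convexCore hfin
  set c : ℝ≥0∞ := EReal.exp (-((ENNReal.ofReal C : ℝ≥0∞) : EReal)) with hc
  have hc0 : c ≠ 0 := by simp [hc]
  have hct : c ≠ ∞ := by
    refine ne_top_of_le_ne_top ENNReal.one_ne_top ?_
    rw [hc, EReal.exp_le_one_iff, EReal.neg_le_zero]
    exact EReal.coe_ennreal_nonneg _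
  have hle : c * jeffreys Q (leftTruncated Q β₀)
      ≤ condJeffreys Q (leftTruncated Q β₀) (fun _ : Fin 1 => mean Q (β₀ / 2)) := by
    have hae := meanRange_leftTruncated_ae_eq hsup hβ₀
    rw [jeffreys, condJeffreys, setLIntegral_congr hae, setLIntegral_congr hae,
      ← lintegral_const_mul' _ _ hct]
    refine setLIntegral_mono' (measurableSet_image_mean hsup hβ₀) ?_
    rintro _ ⟨β, hβ, rfl⟩
    refine mul_le_mul_left ?_ _
    have hs : sampleMean (fun _ : Fin 1 => mean Q (β₀ / 2)) = mean Q (β₀ / 2) := by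
      simp [sampleMean]
    rw [hs, atMean_mean hQ hfin, atMean_mean hQ (mem_finiteMean (hsub hβ)), hc,
      EReal.exp_le_exp_iff, EReal.neg_le_neg_iff, EReal.coe_ennreal_le_coe_ennreal_iff]
    simpa using hC β (interior_subset (hsub hβ)) hβ
  by_contra hJ
  rw [not_lt, top_le_iff] at hJ
  rw [hJ, ENNReal.mul_top hc0] at hle
  exact absurd hlt (not_lt.2 hle)

/-! ### Right moments from a power tail -/

lemma setLIntegral_Ici_rpow_lt_top {ν : Measure ℝ} (hν : ν = volume ∨ ν = countingMeasure)
    {p K : ℝ} (hp : p < -1) (hK : 1 ≤ K) :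
    ∫⁻ x in Set.Ici K, ENNReal.ofReal (x ^ p) ∂ν < ∞ := by
  rcases hν with rfl | rfl
  · have h : IntegrableOn (fun x : ℝ => x ^ p) (Set.Ici K) volume := by
      rw [integrableOn_Ici_iff_integrableOn_Ioi]
      exact integrableOn_Ioi_rpow_of_lt hp (by linarith)
    exact h.lintegral_lt_top
  · have hm : Measurable fun k : ℤ => (k : ℝ) := measurable_from_top
    rw [← lintegral_indicator measurableSet_Ici, countingMeasure,
      lintegral_map (Measurable.indicator (by fun_prop) measurableSet_Ici) hm, lintegral_count]
    have hs : Summable fun k : ℤ => |(k : ℝ)| ^ p := by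
      have := Real.summable_abs_int_rpow (b := -p) (by linarith)
      simpa using this
    refine lt_of_le_of_lt (ENNReal.tsum_le_tsum fun k => ?_) hs.tsum_ofReal_lt_top
    by_cases hk : (k : ℝ) ∈ Set.Ici K
    · rw [Set.indicator_of_mem hk, abs_of_nonneg (by have : K ≤ k := hk; linarith)]
    · rw [Set.indicator_of_notMem hk]
      exact zero_le

/-- A density with a power tail has finite right moments of small positive order. -/
lemma integrable_rpow_max_of_isBigO [IsProbabilityMeasure Q] {ν : Measure ℝ}
    (hν : ν = volume ∨ ν = countingMeasure) {q : ℝ → ℝ} (hq : Measurable q)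
    (hQ : Q = ν.withDensity (fun x => ENNReal.ofReal (q x))) {α ε : ℝ} (hε : 0 < ε) (hεα : ε < α)
    (hO : q =O[atTop ⊓ ae ν] (fun x : ℝ => x ^ (-1 - α))) :
    Integrable (fun x : ℝ => max x 0 ^ ε) Q := by
  obtain ⟨C, hC⟩ := hO.bound
  obtain ⟨s, hs, t, ht, hst⟩ := mem_inf_iff_superset.1 hC
  obtain ⟨K₀, hK₀⟩ := mem_atTop_sets.1 hs
  set K := max K₀ 1 with hK
  have hmeas : Measurable fun x : ℝ => max x 0 ^ ε := by fun_prop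
  have h1 : IntegrableOn (fun x : ℝ => max x 0 ^ ε) (Set.Ici K) Q := by
    refine ⟨hmeas.aestronglyMeasurable, ?_⟩
    rw [hasFiniteIntegral_iff_ofReal (ae_of_all _ fun x => Real.rpow_nonneg (le_max_right _ _) _),
      hQ, setLIntegral_withDensity_eq_setLIntegral_mul _ hq.ennreal_ofReal hmeas.ennreal_ofReal
        measurableSet_Ici]
    have hle : ∀ᵐ x ∂ν, x ∈ Set.Ici K →
        ((fun x => ENNReal.ofReal (q x)) * fun x => ENNReal.ofReal (max x 0 ^ ε)) x
          ≤ ENNReal.ofReal C * ENNReal.ofReal (x ^ (-1 - α + ε)) := by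
      filter_upwards [ht] with x hxt hx
      have hxK : K ≤ x := hx
      have hx0 : 0 < x := by linarith [le_max_right K₀ 1]
      have hb : ‖q x‖ ≤ C * ‖x ^ (-1 - α)‖ := hst ⟨hK₀ x ((le_max_left _ _).trans hxK), hxt⟩
      rw [Real.norm_of_nonneg (Real.rpow_nonneg hx0.le _)] at hb
      have hq' := (Real.le_norm_self (q x)).trans hb
      rw [Pi.mul_apply, max_eq_left hx0.le, Real.rpow_add hx0,
        ENNReal.ofReal_mul (Real.rpow_nonneg hx0.le _), ← mul_assoc]
      gcongr
      rw [← ENNReal.ofReal_mul' (Real.rpow_nonneg hx0.le _)]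
      exact ENNReal.ofReal_le_ofReal hq'
    refine (setLIntegral_mono_ae' measurableSet_Ici hle).trans_lt ?_
    rw [lintegral_const_mul' _ _ ENNReal.ofReal_ne_top]
    exact ENNReal.mul_lt_top ENNReal.ofReal_lt_top
      (setLIntegral_Ici_rpow_lt_top hν (by linarith) (le_max_right _ _))
  have h2 : IntegrableOn (fun x : ℝ => max x 0 ^ ε) (Set.Iio K) Q := by
    refine Measure.integrableOn_of_bounded (M := K ^ ε) (measure_ne_top _ _)
      hmeas.aestronglyMeasurable ?_
    refine (ae_restrict_iff' measurableSet_Iio).2 (ae_of_all _ fun x hx => ?_)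
    rw [Real.norm_of_nonneg (Real.rpow_nonneg (le_max_right _ _) _)]
    have hxK : x < K := hx
    exact Real.rpow_le_rpow (le_max_right _ _)
      (max_le hxK.le (zero_le_one.trans (le_max_right _ _))) hε.le
  rw [← integrableOn_univ, ← Set.Iio_union_Ici (a := K)]
  exact h2.union h1

/-! ### Growth of the variance near zero -/

lemma rpow_mul_exp_neg_le {t p : ℝ} (ht : 0 ≤ t) (hp0 : 0 ≤ p) (hp2 : p ≤ 2) :
    t ^ p * Real.exp (-t) ≤ 3 := by
  have h1 : t ^ p ≤ 1 + t ^ 2 := by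
    rcases le_total t 1 with h | h
    · nlinarith [Real.rpow_le_one ht h hp0, sq_nonneg t]
    · have := Real.rpow_le_rpow_of_exponent_le h hp2
      rw [Real.rpow_two] at this
      linarith
  have h2 := Real.quadratic_le_exp_of_nonneg ht
  have h3 : t ^ p ≤ 3 * Real.exp t := by nlinarith [Real.one_le_exp ht]
  calc t ^ p * Real.exp (-t) ≤ 3 * Real.exp t * Real.exp (-t) := by gcongr
    _ = 3 := by rw [mul_assoc, ← Real.exp_add]; simp

/-- For `x ≤ 0`, `exp(β x)` is at most `exp(β₀ x)`. For `x ≥ 0`, write `x² = x^ε x^(2-ε)` and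
rescale by `t = -β x`, using that `t^(2-ε) exp(-t)` is bounded. -/
lemma sq_mul_exp_le {β₀ β ε : ℝ} (hβ : β ∈ Set.Ioo β₀ 0) (hε : 0 < ε) (hε2 : ε ≤ 2) (x : ℝ) :
    Real.exp (β * x) * x ^ 2
      ≤ Real.exp (β₀ * x) * x ^ 2 + 3 * (-β) ^ (-(2 - ε)) * max x 0 ^ ε := by
  have hb : 0 < -β := neg_pos.2 hβ.2
  have hb' := Real.rpow_pos_of_pos hb (-(2 - ε))
  rcases le_total x 0 with h | h
  · have : Real.exp (β * x) ≤ Real.exp (β₀ * x) :=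
      Real.exp_le_exp.2 (mul_le_mul_of_nonpos_right hβ.1.le h)
    rw [max_eq_right h, Real.zero_rpow hε.ne', mul_zero, add_zero]
    gcongr
  · have key := rpow_mul_exp_neg_le (mul_nonneg hb.le h) (p := 2 - ε) (by linarith) (by linarith)
    have h2 : x ^ 2 = x ^ ε * x ^ (2 - ε) := by
      rw [← Real.rpow_add_of_nonneg h hε.le (by linarith), add_sub_cancel, Real.rpow_two]
    have h3 : x ^ (2 - ε) = (-β) ^ (-(2 - ε)) * (-β * x) ^ (2 - ε) := by
      rw [Real.mul_rpow hb.le h, ← mul_assoc, ← Real.rpow_add hb]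
      simp
    have h4 : Real.exp (β * x) * x ^ 2 = ((-β * x) ^ (2 - ε) * Real.exp (-(-β * x)))
        * ((-β) ^ (-(2 - ε)) * x ^ ε) := by
      rw [h2, h3]
      ring_nf
    have hx := Real.rpow_nonneg h ε
    rw [max_eq_left h, h4]
    have : (-β * x) ^ (2 - ε) * Real.exp (-(-β * x)) * ((-β) ^ (-(2 - ε)) * x ^ ε)
        ≤ 3 * ((-β) ^ (-(2 - ε)) * x ^ ε) := by gcongr
    nlinarith [mul_nonneg (Real.exp_pos (β₀ * x)).le (sq_nonneg x)]

/-- If `Q` has a right moment of order `ε`, then the variance of `P_β` grows at most like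
`|β| ^ (ε - 2)` as `β` increases to `0`. -/
lemma exists_variance_element_le [IsProbabilityMeasure Q] {β₀ ε : ℝ}
    (hsup : IsLUB (canonicalSpace Q) 0) (hβ₀ : β₀ ∈ interior (canonicalSpace Q))
    (hε : 0 < ε) (hε2 : ε ≤ 2) (hmom : Integrable (fun x : ℝ => max x 0 ^ ε) Q) :
    ∃ C : ℝ, 0 ≤ C ∧ ∀ β ∈ Set.Ioo β₀ 0,
      variance (fun x : ℝ => x) (element Q β) ≤ C * (-β) ^ (-(2 - ε)) := by
  have hneg := neg_of_mem_interior_canonicalSpace hsup hβ₀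
  have hsub := Ioo_subset_interior_canonicalSpace hneg hβ₀
  have hsq : ∀ β ∈ interior (canonicalSpace Q),
      Integrable (fun x : ℝ => Real.exp (β * x) * x ^ 2) Q := fun β hβ => by
    have := integrable_pow_mul_exp_of_mem_interior_integrableExpSet (X := id) (μ := Q) hβ 2
    simpa [mul_comm] using this
  -- This integrand lies below `exp(β x)` for every `β ∈ (β₀, 0)`, so its integral bounds `Z(β)`
  -- below uniformly.
  have hmin : Integrable (fun x => Real.exp (min (β₀ * x) 0)) Q := by
    refine Integrable.of_bound (by fun_prop) 1 (ae_of_all _ fun x => ?_)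
    rw [Real.norm_of_nonneg (Real.exp_pos _).le]
    exact Real.exp_le_one_iff.2 (min_le_right _ _)
  set c := ∫ x, Real.exp (min (β₀ * x) 0) ∂Q with hc
  have hcpos : 0 < c := integral_exp_pos hmin
  set A := ∫ x, Real.exp (β₀ * x) * x ^ 2 ∂Q with hA
  set B := ∫ x, max x 0 ^ ε ∂Q with hB
  have hA0 : 0 ≤ A := integral_nonneg fun x => mul_nonneg (Real.exp_pos _).le (sq_nonneg x)
  have hB0 : 0 ≤ B := integral_nonneg fun x => Real.rpow_nonneg (le_max_right _ _) _
  have hβ₀p : 0 < (-β₀) ^ (2 - ε) := Real.rpow_pos_of_pos (neg_pos.2 hneg) _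
  refine ⟨(A * (-β₀) ^ (2 - ε) + 3 * B) / c, by positivity, fun β hβ => ?_⟩
  have hb : 0 < -β := neg_pos.2 hβ.2
  have hmem := interior_subset (hsub hβ)
  have := isProbabilityMeasure_element hmem
  have hb' := Real.rpow_pos_of_pos hb (-(2 - ε))
  have hZ : c ≤ ∫ x, Real.exp (β * x) ∂Q := by
    refine integral_mono hmin hmem fun x => Real.exp_le_exp.2 ?_
    rcases le_total x 0 with h | h
    · exact (min_le_right _ _).trans (mul_nonneg_of_nonpos_of_nonpos hβ.2.le h)
    · exact (min_le_left _ _).trans (mul_le_mul_of_nonneg_right hβ.1.le h)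
  have hnum : ∫ x, Real.exp (β * x) * x ^ 2 ∂Q ≤ A + 3 * (-β) ^ (-(2 - ε)) * B := by
    rw [hA, hB, ← integral_const_mul, ← integral_add (hsq _ hβ₀) (hmom.const_mul _)]
    exact integral_mono (hsq _ (hsub hβ)) ((hsq _ hβ₀).add (hmom.const_mul _))
      fun x => sq_mul_exp_le hβ hε hε2 x
  -- Lets the constant `A` be absorbed into the factor that blows up at `0`.
  have hone : 1 ≤ (-β₀) ^ (2 - ε) * (-β) ^ (-(2 - ε)) := by
    rw [Real.rpow_neg hb.le, ← div_eq_mul_inv, one_le_div (Real.rpow_pos_of_pos hb _)]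
    exact Real.rpow_le_rpow hb.le (by linarith [hβ.1]) (by linarith)
  calc variance (fun x : ℝ => x) (element Q β)
      ≤ ∫ x, x ^ 2 ∂(element Q β) :=
        variance_le_expectation_sq (X := fun x : ℝ => x) measurable_id.aestronglyMeasurable
    _ = (∫ x, Real.exp (β * x) * x ^ 2 ∂Q) / ∫ x, Real.exp (β * x) ∂Q := by
        rw [element, integral_tilted, ← integral_div]
        refine integral_congr_ae (ae_of_all _ fun x => ?_)
        simp only [smul_eq_mul]
        ring
    _ ≤ (A + 3 * (-β) ^ (-(2 - ε)) * B) / c := by gcongr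
    _ ≤ (A * ((-β₀) ^ (2 - ε) * (-β) ^ (-(2 - ε))) + 3 * (-β) ^ (-(2 - ε)) * B) / c := by
        gcongr
        exact le_mul_of_one_le_right hA0 hone
    _ = _ := by ring

/-! ### Finiteness of the Jeffreys integral -/

/-- The Jeffreys integral in terms of the canonical parameter. -/
lemma jeffreys_le_lintegral_variance [IsProbabilityMeasure Q] {β₀ : ℝ}
    (hsup : IsLUB (canonicalSpace Q) 0) (hβ₀ : β₀ ∈ interior (canonicalSpace Q)) :
    jeffreys Q (leftTruncated Q β₀) ≤ ∫⁻ β in Set.Ioo β₀ 0,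
      ENNReal.ofReal (variance (fun x : ℝ => x) (element Q β)) ^ (1 / 2 : ℝ) := by
  have hsub := Ioo_subset_interior_canonicalSpace (neg_of_mem_interior_canonicalSpace hsup hβ₀) hβ₀
  have hQ := not_ae_eq_const hsup
  rw [jeffreys, setLIntegral_congr (meanRange_leftTruncated_ae_eq hsup hβ₀),
    lintegral_image_eq_lintegral_abs_deriv_mul measurableSet_Ioo
      (fun β hβ => (hasDerivAt_mean (hsub hβ)).hasDerivWithinAt)
      ((mean_strictMonoOn hQ).injOn.mono fun β hβ => mem_finiteMean (hsub hβ))]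
  refine setLIntegral_mono' measurableSet_Ioo fun β hβ => ?_
  have := isProbabilityMeasure_element (interior_subset (hsub hβ))
  rw [varFun, atMean_mean hQ (mem_finiteMean (hsub hβ)), ← ofReal_variance (memLp_element (hsub hβ)),
    abs_of_nonneg (variance_nonneg _ _)]
  -- At zero variance `V^(-1/2) = ∞`, but the Jacobian vanishes and `0 * ∞ = 0`.
  rcases eq_or_ne (ENNReal.ofReal (variance (fun x : ℝ => x) (element Q β))) 0 with h | h
  · simp [h]
  · nth_rewrite 1 [← ENNReal.rpow_one (ENNReal.ofReal (variance (fun x : ℝ => x) (element Q β)))]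
    rw [← ENNReal.rpow_add _ _ h ENNReal.ofReal_ne_top]
    norm_num

lemma jeffreys_lt_top_of_integrable_rpow [IsProbabilityMeasure Q] {β₀ ε : ℝ}
    (hsup : IsLUB (canonicalSpace Q) 0) (hβ₀ : β₀ ∈ interior (canonicalSpace Q))
    (hε : 0 < ε) (hε2 : ε ≤ 2) (hmom : Integrable (fun x : ℝ => max x 0 ^ ε) Q) :
    jeffreys Q (leftTruncated Q β₀) < ∞ := by
  obtain ⟨C, hC0, hC⟩ := exists_variance_element_le hsup hβ₀ hε hε2 hmom
  have hneg := neg_of_mem_interior_canonicalSpace hsup hβ₀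
  refine (jeffreys_le_lintegral_variance hsup hβ₀).trans_lt ?_
  have hint : IntegrableOn (fun β : ℝ => C ^ (1 / 2 : ℝ) * (-β) ^ (-(2 - ε) / 2))
      (Set.Ioo β₀ 0) := by
    -- The exponent `ε/2 - 1` exceeds `-1`.
    have h1 : IntervalIntegrable (fun t : ℝ => t ^ (-(2 - ε) / 2)) volume (-β₀) (-0) :=
      intervalIntegral.intervalIntegrable_rpow' (by linarith)
    have h2 := ((IntervalIntegrable.iff_comp_neg (by finiteness)).1 h1).const_mul (C ^ (1 / 2 : ℝ))
    rw [neg_neg, neg_neg, intervalIntegrable_iff_integrableOn_Ioo_of_le hneg.le] at h2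
    exact h2
  refine lt_of_le_of_lt (setLIntegral_mono' measurableSet_Ioo fun β hβ => ?_)
    hint.lintegral_lt_top
  have hb : 0 ≤ -β := (neg_pos.2 hβ.2).le
  calc ENNReal.ofReal (variance (fun x : ℝ => x) (element Q β)) ^ (1 / 2 : ℝ)
      ≤ ENNReal.ofReal (C * (-β) ^ (-(2 - ε))) ^ (1 / 2 : ℝ) := by
        gcongr
        exact hC β hβ
    _ = ENNReal.ofReal (C ^ (1 / 2 : ℝ) * (-β) ^ (-(2 - ε) / 2)) := by
        rw [ENNReal.ofReal_rpow_of_nonneg (mul_nonneg hC0 (Real.rpow_nonneg hb _)) (by norm_num),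
          Real.mul_rpow hC0 (Real.rpow_nonneg hb _), ← Real.rpow_mul hb, mul_one_div]

end ExpFamily

theorem mainTheorem9 (Q : Measure ℝ) [IsProbabilityMeasure Q]
    (ν : Measure ℝ) (hν : ν = volume ∨ ν = ExpFamily.countingMeasure)
    (q : ℝ → ℝ) (hq : Measurable q) (hq0 : ∀ x, 0 ≤ q x)
    (hQ : Q = ν.withDensity (fun x => ENNReal.ofReal (q x)))
    (hsup : IsLUB (ExpFamily.canonicalSpace Q) 0)
    (β₀ : ℝ) (hβ₀ : β₀ ∈ interior (ExpFamily.canonicalSpace Q)) :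
    (ExpFamily.IsHeavyTailed Q →
      (ExpFamily.jeffreys Q (ExpFamily.leftTruncated Q β₀) < ∞ ↔
        ∀ m : ℕ, 1 ≤ m → ∀ s : Fin m → ℝ, (∀ i, s i ∈ ExpFamily.convexCore Q) →
          ExpFamily.condJeffreys Q (ExpFamily.leftTruncated Q β₀) s < ∞)) ∧
    (∀ α : ℝ, 0 < α →
      q =O[atTop ⊓ ae ν] (fun x : ℝ => x ^ (-1 - α)) →
      ExpFamily.jeffreys Q (ExpFamily.leftTruncated Q β₀) < ∞) := by
  refine ⟨fun _ => ExpFamily.jeffreys_lt_top_iff_condJeffreys_lt_top hsup hβ₀, fun α hα hO => ?_⟩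
  -- The moment order must lie strictly below `α` and not exceed `2`.
  have hε : 0 < min (α / 2) 1 := lt_min (by linarith) one_pos
  have hεα : min (α / 2) 1 < α := (min_le_left _ _).trans_lt (by linarith)
  exact ExpFamily.jeffreys_lt_top_of_integrable_rpow hsup hβ₀ hε
    ((min_le_right _ _).trans one_le_two)
    (ExpFamily.integrable_rpow_max_of_isBigO hν hq hQ hε hεα hO)
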